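/- There exist absolute constants $c>0$ and $C>0$ with the following property. Let $D>1$ be an integer, let $\chi$ be a real primitive Dirichlet character of conductor $D$, and let $L(s,\chi)$ be its Dirichlet $L$-function, i.e. the analytic continuation of $\sum_{n\ge 1}\chi(n)n^{-s}$. Put $\lambda=1*\chi$, i.e. $\lambda(n)=\sum_{d\mid n}\chi(d)$. Suppose that $L(s,\chi)$ has a real zero $\beta$ with $1-\beta\le (3\log D)^{-1}$, and put $$S(x)=\sum_{1\le n\le x}\lambda(n)\Bigl(1-\frac{n}{x}\Bigr)n^{-\beta}.$$ Then $L(1,\chi)\asymp(1-\beta)S(D)$ with these constants, that is, $L(1,\chi)$ is real and $$c\,(1-\beta)\,S(D)\le L(1,\chi)\le C\,(1-\beta)\,S(D).$$ -/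

import Mathlib

/-- The Dirichlet `L`-function `L(s, χ)` of a real-valued Dirichlet character `χ` modulo `D`:
Mathlib's (meromorphically continued) `L`-function of `χ` regarded as a complex character. -/
noncomputable def realCharLFunction {D : ℕ} [NeZero D] (χ : DirichletCharacter ℝ D) (s : ℂ) : ℂ :=
  DirichletCharacter.LFunction (χ.ringHomComp Complex.ofRealHom) s

/-- The Dirichlet convolution `λ = 1 * χ`, that is `λ(n) = ∑_{d ∣ n} χ(d)`. -/
noncomputable def oneConvChar {D : ℕ} (χ : DirichletCharacter ℝ D) (n : ℕ) : ℝ :=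
  ∑ d ∈ n.divisors, χ (d : ZMod D)

/-- The smoothed sum `S(x) = ∑_{1 ≤ n ≤ x} λ(n) (1 - n / x) n ^ (-β)`. -/
noncomputable def smoothedSum {D : ℕ} (χ : DirichletCharacter ℝ D) (β x : ℝ) : ℝ :=
  ∑ n ∈ Finset.Icc 1 ⌊x⌋₊, oneConvChar χ n * (1 - (n : ℝ) / x) * (n : ℝ) ^ (-β)

/-!
Write `A(t) = ∑_{k ≤ t} χ(k)`. Partial summation gives `L(s, χ) = s ∫_1^∞ A(t) t ^ (-s - 1) dt` for
`re s > 0` (`DirichletCharacter.LFunction_eq_mul_integral`). Opening `λ = 1 * χ` and summing by parts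
over the variable carrying `χ` gives likewise
`S(x) = ∫_1^x A(t) t ^ (-β - 1) H(x / t) dt` with
`H(y) = ∑_{a ≤ y} a ^ (-β) (β + (1 - β) a / y)` (`smoothedSum_eq_integral`).

Elementary estimates for sums of powers yield `H(y) = R(y) + O(y ^ (-β))` for `y ≥ 1`, where
`R(y) = y ^ (1 - β) / ((1 - β) (2 - β)) + β K` for a constant `K`. Replace `H` by `R` and extend the
integral to infinity. The first term of `R` then contributes exactly
`L(1, χ) x ^ (1 - β) / ((1 - β) (2 - β))`, and the second one contributes `K L(β, χ) = 0`. The error is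
`O(x ^ (-β) log x · sup |A|)`, uniformly in `β`, because for `y ≤ 1` the two terms of `R(y)`, each of
size `1 / (1 - β)`, nearly cancel (`exists_abs_kernel_sub_le`, `abs_smoothedSum_sub_le`). This replaces
the usual contour shift for `ζ(s + β) L(s + β, χ)`.

By the Pólya–Vinogradov inequality (`DirichletCharacter.IsPrimitive.norm_sum_le`)
`sup |A| ≤ √D (1 + log D)`, so at `x = D` the error is `O(D ^ (-1 / 2) (log D) ^ 2)`. Since `λ ≥ 0` and
`λ(1) = 1`, the sum `S(D)` is at least `2 / 3`; and `D ^ (1 - β)` is bounded. This proves the claim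
for all large `D` (`exists_forall_large_conductor`). Only finitely many characters remain, and for
each of them the zeros `β` stay away from `1` because `L(1, χ) ≠ 0` (`exists_forall_zero`).
-/

open MeasureTheory Filter Topology

/-! ### The Pólya–Vinogradov inequality -/

/-- The Gauss sum of a primitive character modulo `D` has absolute value `√D`. -/
lemma DirichletCharacter.IsPrimitive.norm_gaussSum_sq {D : ℕ} [NeZero D]
    {χ : DirichletCharacter ℂ D} (hχ : χ.IsPrimitive) :
    ‖gaussSum χ ZMod.stdAddChar‖ ^ 2 = D := by
  have h1 : ‖gaussSum χ⁻¹ ZMod.stdAddChar‖ = ‖gaussSum χ ZMod.stdAddChar‖ := by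
    rw [← norm_star (gaussSum χ ZMod.stdAddChar), star_gaussSum_eq, AddChar.inv_mulShift,
      ← Units.coe_neg_one, gaussSum_mulShift_eq, norm_mul, DirichletCharacter.unit_norm_eq_one,
      one_mul]
  have h2 := congrFun (ZMod.dft_dft (⇑χ)) (-1)
  have h3 : ZMod.dft (ZMod.dft (⇑χ)) (-1) =
      gaussSum χ ZMod.stdAddChar * (χ⁻¹ (-1) * gaussSum χ⁻¹ ZMod.stdAddChar) := by
    rw [ZMod.dft_apply, gaussSum, gaussSum, Finset.mul_sum, Finset.mul_sum]
    refine Finset.sum_congr rfl fun k _ ↦ ?_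
    rw [hχ.fourierTransform_eq_inv_mul_gaussSum, gaussSum, ← neg_one_mul k, map_mul]
    simp only [mul_neg, mul_one, neg_neg, smul_eq_mul]
    ring
  rw [h3] at h2
  have h4 := congrArg norm h2
  have h5 : ‖χ⁻¹ (-1)‖ = 1 := by
    rw [← Units.coe_neg_one, DirichletCharacter.unit_norm_eq_one]
  simpa [h1, h5, ← pow_two] using h4

/-- Fourier expansion of a primitive character in additive characters. -/
lemma DirichletCharacter.IsPrimitive.apply_eq_sum {D : ℕ} [NeZero D]
    {χ : DirichletCharacter ℂ D} (hχ : χ.IsPrimitive) (n : ℕ) :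
    (D : ℂ) * χ n = gaussSum χ ZMod.stdAddChar *
      ∑ k : ZMod D, χ⁻¹ (-k) * (ZMod.stdAddChar k) ^ n := by
  have h2 := congrFun (ZMod.dft_dft (⇑χ)) (-(n : ZMod D))
  simp only [neg_neg, smul_eq_mul] at h2
  rw [← h2, ZMod.dft_apply, Finset.mul_sum]
  refine Finset.sum_congr rfl fun k _ ↦ ?_
  rw [hχ.fourierTransform_eq_inv_mul_gaussSum, ← AddChar.map_nsmul_eq_pow, nsmul_eq_mul]
  simp only [mul_neg, neg_neg, smul_eq_mul]
  rw [mul_comm k]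
  ring

/-- A lower bound for `|exp(2πit) - 1|` whose reciprocal splits as `(1 / t + 1 / (1 - t)) / 4`. -/
lemma four_mul_mul_one_sub_le_two_mul_sin {t : ℝ} (h0 : 0 ≤ t) (h1 : t ≤ 1) :
    4 * (t * (1 - t)) ≤ 2 * Real.sin (Real.pi * t) := by
  have key : ∀ u : ℝ, 0 ≤ u → u ≤ 1 / 2 → 2 * u ≤ Real.sin (Real.pi * u) := fun u h0 h1 ↦ by
    have := Real.mul_le_sin (x := Real.pi * u) (by positivity)
      (by nlinarith [Real.pi_pos])
    calc 2 * u = 2 / Real.pi * (Real.pi * u) := by field_simp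
      _ ≤ _ := this
  rcases le_total t (1 / 2) with h | h
  · nlinarith [key t h0 h]
  · have := key (1 - t) (by linarith) (by linarith)
    rw [show Real.pi * (1 - t) = Real.pi - Real.pi * t by ring, Real.sin_pi_sub] at this
    nlinarith

lemma norm_sum_Icc_pow_le {z : ℂ} (hz : ‖z‖ = 1) (hz1 : z ≠ 1) (N : ℕ) :
    ‖∑ n ∈ Finset.Icc 1 N, z ^ n‖ ≤ 2 / ‖z - 1‖ := by
  have h : ∑ n ∈ Finset.Icc 1 N, z ^ n = z * ((z ^ N - 1) / (z - 1)) := by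
    rw [← geom_sum_eq hz1, Finset.mul_sum, ← Finset.Ico_add_one_right_eq_Icc,
      Finset.sum_Ico_eq_sum_range]
    simp [pow_add]
  rw [h, norm_mul, hz, one_mul, norm_div]
  gcongr
  calc ‖z ^ N - 1‖ ≤ ‖z ^ N‖ + ‖(1 : ℂ)‖ := norm_sub_le _ _
    _ = 2 := by rw [norm_pow, hz]; norm_num

lemma norm_sum_Icc_stdAddChar_pow_le {D : ℕ} [NeZero D] {k : ZMod D} (hk : k ≠ 0) (N : ℕ) :
    ‖∑ n ∈ Finset.Icc 1 N, (ZMod.stdAddChar k : ℂ) ^ n‖ ≤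
      D / 2 * ((k.val : ℝ)⁻¹ + ((D : ℝ) - k.val)⁻¹) := by
  have hD : (0 : ℝ) < D := by exact_mod_cast NeZero.pos D
  have hk0 : (0 : ℝ) < k.val := by
    exact_mod_cast Nat.pos_of_ne_zero (by simpa using hk)
  have hkD : (k.val : ℝ) < D := by exact_mod_cast ZMod.val_lt k
  have hz : (ZMod.stdAddChar k : ℂ) =
      Complex.exp (Complex.I * ((2 * Real.pi * (k.val / D) : ℝ) : ℂ)) := by
    have := ZMod.stdAddChar_coe (N := D) (k.val : ℤ)
    rw [Int.cast_natCast, ZMod.natCast_zmod_val] at this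
    rw [this]
    push_cast
    congr 1
    ring
  have hnorm : ‖(ZMod.stdAddChar k : ℂ)‖ = 1 := by simp
  have hne : (ZMod.stdAddChar k : ℂ) ≠ 1 := by
    intro h
    apply hk
    apply ZMod.injective_stdAddChar
    rw [h, AddChar.map_zero_eq_one]
  refine (norm_sum_Icc_pow_le hnorm hne N).trans ?_
  have h1 : 4 * ((k.val : ℝ) / D * (1 - k.val / D)) ≤ ‖(ZMod.stdAddChar k : ℂ) - 1‖ := by
    rw [hz, Complex.norm_exp_I_mul_ofReal_sub_one]
    refine (four_mul_mul_one_sub_le_two_mul_sin (by positivity) ?_).trans ?_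
    · rw [div_le_one hD]; exact hkD.le
    · rw [show 2 * Real.pi * ((k.val : ℝ) / D) / 2 = Real.pi * (k.val / D) by ring]
      exact Real.le_norm_self _
  have h2 : 0 < (k.val : ℝ) / D * (1 - k.val / D) := by
    have : (k.val : ℝ) / D < 1 := by rw [div_lt_one hD]; exact hkD
    have : 0 < (k.val : ℝ) / D := by positivity
    apply mul_pos <;> linarith
  calc 2 / ‖(ZMod.stdAddChar k : ℂ) - 1‖ ≤ 2 / (4 * ((k.val : ℝ) / D * (1 - k.val / D))) := by
        gcongr
    _ = _ := by
      have : (D : ℝ) - k.val ≠ 0 := by linarith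
      field_simp
      ring

/-- The **Pólya–Vinogradov inequality**. -/
theorem DirichletCharacter.IsPrimitive.norm_sum_le {D : ℕ} [NeZero D]
    {χ : DirichletCharacter ℂ D} (hχ : χ.IsPrimitive) (hD : 1 < D) (N : ℕ) :
    ‖∑ n ∈ Finset.Icc 1 N, χ n‖ ≤ √D * (1 + Real.log D) := by
  have hD0 : (0 : ℝ) < D := by exact_mod_cast NeZero.pos D
  have hg : ‖gaussSum χ ZMod.stdAddChar‖ = √D := by
    rw [← hχ.norm_gaussSum_sq, Real.sqrt_sq (norm_nonneg _)]
  have : Fact (1 < D) := ⟨hD⟩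
  have h1 : (D : ℂ) * ∑ n ∈ Finset.Icc 1 N, χ n = gaussSum χ ZMod.stdAddChar *
      ∑ k : ZMod D, χ⁻¹ (-k) * ∑ n ∈ Finset.Icc 1 N, (ZMod.stdAddChar k : ℂ) ^ n := by
    simp_rw [Finset.mul_sum, hχ.apply_eq_sum, Finset.mul_sum]
    rw [Finset.sum_comm]
  have h2 : ‖∑ k : ZMod D, χ⁻¹ (-k) * ∑ n ∈ Finset.Icc 1 N, (ZMod.stdAddChar k : ℂ) ^ n‖ ≤
      ∑ k ∈ Finset.univ.erase (0 : ZMod D),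
        (D : ℝ) / 2 * ((k.val : ℝ)⁻¹ + ((D : ℝ) - k.val)⁻¹) := by
    rw [← Finset.add_sum_erase _ _ (Finset.mem_univ 0), neg_zero,
      MulChar.map_nonunit χ⁻¹ not_isUnit_zero, zero_mul, zero_add]
    refine norm_sum_le_of_le _ fun k hk ↦ ?_
    rw [norm_mul]
    have := norm_sum_Icc_stdAddChar_pow_le (Finset.ne_of_mem_erase hk) N
    calc _ ≤ 1 * ‖∑ n ∈ Finset.Icc 1 N, (ZMod.stdAddChar k : ℂ) ^ n‖ := by
          gcongr; exact DirichletCharacter.norm_le_one _ _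
      _ ≤ _ := by rw [one_mul]; exact this
  have h3 : ∑ k ∈ Finset.univ.erase (0 : ZMod D),
        (D : ℝ) / 2 * ((k.val : ℝ)⁻¹ + ((D : ℝ) - k.val)⁻¹) =
      ∑ i ∈ Finset.Ico 1 D, (D : ℝ) / 2 * ((i : ℝ)⁻¹ + ((D : ℝ) - i)⁻¹) := by
    refine Finset.sum_nbij' ZMod.val (fun i ↦ (i : ZMod D)) ?_ ?_ ?_ ?_ ?_
    · intro k hk
      rw [Finset.mem_Ico]
      exact ⟨Nat.one_le_iff_ne_zero.mpr (by simpa using Finset.ne_of_mem_erase hk), ZMod.val_lt k⟩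
    · intro i hi
      rw [Finset.mem_Ico] at hi
      refine Finset.mem_erase.mpr ⟨?_, Finset.mem_univ _⟩
      rw [Ne, ZMod.natCast_eq_zero_iff]
      exact fun h ↦ absurd (Nat.le_of_dvd hi.1 h) (by lia)
    · intro k _
      simp
    · intro i hi
      exact ZMod.val_cast_of_lt (Finset.mem_Ico.mp hi).2
    · intro k _
      rfl
  have h4 : ∑ i ∈ Finset.Ico 1 D, ((D : ℝ) - i)⁻¹ = ∑ i ∈ Finset.Ico 1 D, (i : ℝ)⁻¹ := by
    have h := Finset.sum_Ico_reflect (fun i : ℕ ↦ (i : ℝ)⁻¹) 1 (Nat.le_succ D)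
    rw [Nat.add_sub_cancel_left, Nat.add_sub_cancel] at h
    rw [← h]
    refine Finset.sum_congr rfl fun i hi ↦ ?_
    rw [Nat.cast_sub (Finset.mem_Ico.mp hi).2.le]
  have h5 : ∑ i ∈ Finset.Ico 1 D, (i : ℝ)⁻¹ ≤ 1 + Real.log D := by
    have := harmonic_le_one_add_log D
    rw [harmonic_eq_sum_Icc] at this
    push_cast at this
    refine le_trans (Finset.sum_le_sum_of_subset_of_nonneg ?_ fun i _ _ ↦ by positivity) this
    exact Finset.Ico_subset_Icc_self
  rw [h3, ← Finset.mul_sum, Finset.sum_add_distrib, h4, ← two_mul] at h2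
  have h6 := congrArg norm h1
  rw [norm_mul, norm_mul, hg, Complex.norm_natCast] at h6
  have h7 : (D : ℝ) * ‖∑ n ∈ Finset.Icc 1 N, χ n‖ ≤ D * (√D * (1 + Real.log D)) := by
    rw [h6]
    calc _ ≤ √D * ((D : ℝ) / 2 * (2 * ∑ i ∈ Finset.Ico 1 D, (i : ℝ)⁻¹)) := by gcongr
      _ ≤ √D * ((D : ℝ) / 2 * (2 * (1 + Real.log D))) := by gcongr
      _ = _ := by ring
  exact le_of_mul_le_mul_left h7 hD0

/-! ### The `L`-function as an integral of character sums -/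

open Complex in
/-- If the partial sums of a nontrivial character are bounded, partial summation represents its
`L`-function in the whole half-plane `0 < re s`, where the Dirichlet series converges only
conditionally. -/
theorem DirichletCharacter.LFunction_eq_mul_integral {D : ℕ} [NeZero D]
    {χ : DirichletCharacter ℂ D} (hχ : χ ≠ 1) {M : ℝ}
    (hM : ∀ N : ℕ, ‖∑ k ∈ Finset.Icc 1 N, χ k‖ ≤ M) {s : ℂ} (hs : 0 < s.re) :
    χ.LFunction s =
      s * ∫ t in Set.Ioi (1 : ℝ), (∑ k ∈ Finset.Icc 1 ⌊t⌋₊, χ k) * (t : ℂ) ^ (-(s + 1)) := by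
  set A : ℝ → ℂ := (Set.Ioi (1 : ℝ)).indicator (fun t ↦ ∑ k ∈ Finset.Icc 1 ⌊t⌋₊, χ k) with hA
  have hAM : ∀ t, ‖A t‖ ≤ M := fun t ↦
    (norm_indicator_le_norm_self _ _).trans (hM _)
  have hmellin : ∀ s : ℂ, ∫ t in Set.Ioi (1 : ℝ),
      (∑ k ∈ Finset.Icc 1 ⌊t⌋₊, χ k) * (t : ℂ) ^ (-(s + 1)) = mellin A (-s) := by
    intro s
    rw [mellin]
    have h1 : ∀ t : ℝ, (t : ℂ) ^ (-s - 1) • A t = (Set.Ioi (1 : ℝ)).indicator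
        (fun t : ℝ ↦ (∑ k ∈ Finset.Icc 1 ⌊t⌋₊, χ k) * (t : ℂ) ^ (-(s + 1))) t := by
      intro t
      by_cases ht : t ∈ Set.Ioi (1 : ℝ)
      · rw [hA, Set.indicator_of_mem ht, Set.indicator_of_mem ht, smul_eq_mul, mul_comm,
          neg_add']
      · rw [hA, Set.indicator_of_notMem ht, Set.indicator_of_notMem ht, smul_zero]
    simp_rw [h1]
    rw [MeasureTheory.setIntegral_indicator measurableSet_Ioi]
    congr 2
    exact (Set.inter_eq_right.mpr (Set.Ioi_subset_Ioi zero_le_one)).symm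
  rw [hmellin]
  have hmeas : Measurable A :=
    ((measurable_from_nat (f := fun n ↦ ∑ k ∈ Finset.Icc 1 n, χ k)).comp
      Nat.measurable_floor).indicator measurableSet_Ioi
  have hdiff : DifferentiableOn ℂ (fun s : ℂ ↦ s * mellin A (-s)) {s | 0 < s.re} := by
    intro s hs
    refine (differentiableAt_id.mul (DifferentiableAt.comp s
      (mellin_differentiableAt_of_isBigO_rpow (a := 0) (b := -s.re - 1) ?_ ?_ ?_ ?_ ?_)
      differentiableAt_id.neg)).differentiableWithinAt
    · refine MeasureTheory.LocallyIntegrable.locallyIntegrableOn ?_ _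
      exact (MeasureTheory.locallyIntegrable_const M).mono hmeas.aestronglyMeasurable
        (Filter.Eventually.of_forall fun t ↦ (hAM t).trans (Real.le_norm_self M))
    · simp only [neg_zero, Real.rpow_zero]
      exact Asymptotics.IsBigO.of_bound M (Filter.Eventually.of_forall fun t ↦ by simpa using hAM t)
    · simpa using hs
    · refine Asymptotics.IsBigO.of_bound 1 ?_
      filter_upwards [nhdsWithin_le_nhds (Iio_mem_nhds zero_lt_one)] with t ht
      have : t ∉ Set.Ioi (1 : ℝ) := fun h ↦ lt_asymm (Set.mem_Iio.mp ht) (Set.mem_Ioi.mp h)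
      rw [hA, Set.indicator_of_notMem this]
      simp
    · simp
  have hopen : IsOpen {s : ℂ | 0 < s.re} := isOpen_lt continuous_const continuous_re
  refine AnalyticOnNhd.eqOn_of_preconnected_of_eventuallyEq (z₀ := 2)
    ((χ.differentiable_LFunction hχ).differentiableOn.analyticOnNhd hopen)
    (hdiff.analyticOnNhd hopen) (convex_halfSpace_re_gt 0).isPreconnected (by simp) ?_ hs
  have hmem : {s : ℂ | 1 < s.re} ∈ nhds (2 : ℂ) :=
    (isOpen_lt continuous_const continuous_re).mem_nhds (by simp)
  filter_upwards [hmem] with z hz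
  rw [χ.LFunction_eq_LSeries hz, LSeries_eq_mul_integral _ le_rfl (zero_lt_one.trans hz)
    (χ.LSeriesSummable_of_one_lt_re hz), hmellin]
  simp only [Real.rpow_zero]
  exact Asymptotics.IsBigO.of_bound M (Filter.Eventually.of_forall fun t ↦ by simpa using hM t)

/-- The summatory function `∑_{k ≤ t} χ(k)` of a real character. -/
noncomputable def charSum {D : ℕ} (χ : DirichletCharacter ℝ D) (t : ℝ) : ℝ :=
  ∑ k ∈ Finset.Icc 1 ⌊t⌋₊, χ (k : ZMod D)

lemma measurable_charSum {D : ℕ} (χ : DirichletCharacter ℝ D) : Measurable (charSum χ) :=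
  (measurable_from_nat (f := fun n ↦ ∑ k ∈ Finset.Icc 1 n, χ (k : ZMod D))).comp
      Nat.measurable_floor

lemma DirichletCharacter.IsPrimitive.ofReal {D : ℕ} [NeZero D] {χ : DirichletCharacter ℝ D}
    (hχ : χ.IsPrimitive) : DirichletCharacter.IsPrimitive (χ.ringHomComp Complex.ofRealHom) := by
  rw [DirichletCharacter.isPrimitive_def]
  refine Eq.trans ?_ hχ
  unfold DirichletCharacter.conductor
  congr 1
  ext d
  simp only [DirichletCharacter.mem_conductorSet_iff]
  by_cases hd : d ∣ D
  · rw [DirichletCharacter.factorsThrough_iff_ker_unitsMap hd,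
      DirichletCharacter.factorsThrough_iff_ker_unitsMap hd]
    have : (χ.ringHomComp Complex.ofRealHom).toUnitHom.ker = χ.toUnitHom.ker := by
      ext u
      simp [MonoidHom.mem_ker, Units.ext_iff]
    rw [this]
  · exact ⟨fun h ↦ absurd h.dvd hd, fun h ↦ absurd h.dvd hd⟩

lemma abs_charSum_le {D : ℕ} [NeZero D] {χ : DirichletCharacter ℝ D} (hχ : χ.IsPrimitive)
    (hD : 1 < D) (t : ℝ) : |charSum χ t| ≤ √D * (1 + Real.log D) := by
  have := hχ.ofReal.norm_sum_le hD ⌊t⌋₊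
  simpa [charSum, MulChar.ringHomComp_apply, ← Complex.ofReal_sum] using this

lemma DirichletCharacter.IsPrimitive.ne_one {R : Type*} [CommMonoidWithZero R] {D : ℕ}
    [NeZero D] {χ : DirichletCharacter R D} (hχ : χ.IsPrimitive) (hD : 1 < D) : χ ≠ 1 := by
  rintro rfl
  rw [DirichletCharacter.isPrimitive_def, DirichletCharacter.conductor_one] at hχ
  exact hD.ne hχ

/-- On the positive real axis the `L`-function of a real primitive character is real, and is
given by partial summation. -/
lemma realCharLFunction_ofReal {D : ℕ} [NeZero D] {χ : DirichletCharacter ℝ D}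
    (hχ : χ.IsPrimitive) (hD : 1 < D) {σ : ℝ} (hσ : 0 < σ) :
    realCharLFunction χ σ =
      ((σ * ∫ t in Set.Ioi (1 : ℝ), charSum χ t * t ^ (-(σ + 1)) : ℝ) : ℂ) := by
  rw [realCharLFunction, DirichletCharacter.LFunction_eq_mul_integral (hχ.ofReal.ne_one hD)
    (hχ.ofReal.norm_sum_le hD) (by simpa using hσ), Complex.ofReal_mul, ← integral_complex_ofReal]
  congr 1
  refine MeasureTheory.setIntegral_congr_fun measurableSet_Ioi fun t ht ↦ ?_
  have ht0 : (0 : ℝ) ≤ t := zero_le_one.trans (le_of_lt ht)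
  simp only [charSum, Complex.ofReal_mul, Complex.ofReal_sum, Complex.ofReal_cpow ht0,
    MulChar.ringHomComp_apply]
  push_cast
  rfl

/-! ### Sums of powers -/

/-- Concavity of `u ↦ u ^ p`: the increment is at most the derivative at the left end point
times the length. -/
lemma rpow_sub_rpow_le {p u v : ℝ} (hp0 : 0 ≤ p) (hp1 : p ≤ 1) (hu : 0 < u) (hv : 0 ≤ v) :
    v ^ p - u ^ p ≤ p * u ^ (p - 1) * (v - u) := by
  have h := rpow_one_add_le_one_add_mul_self (s := v / u - 1)
    (by linarith [div_nonneg hv hu.le]) hp0 hp1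
  rw [add_sub_cancel, Real.div_rpow hv hu.le, div_le_iff₀ (by positivity)] at h
  rw [Real.rpow_sub_one hu.ne']
  calc _ ≤ (1 + p * (v / u - 1)) * u ^ p - u ^ p := by linarith
    _ = _ := by field_simp; ring

/-- Convexity of `u ↦ u ^ q`: the increment is at least the derivative at the left end point
times the length. -/
lemma le_rpow_sub_rpow {q u v : ℝ} (hq : 1 ≤ q) (hu : 0 < u) (hv : 0 ≤ v) :
    q * u ^ (q - 1) * (v - u) ≤ v ^ q - u ^ q := by
  have h := one_add_mul_self_le_rpow_one_add (s := v / u - 1)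
    (by linarith [div_nonneg hv hu.le]) hq
  rw [add_sub_cancel, Real.div_rpow hv hu.le, le_div_iff₀ (by positivity)] at h
  rw [Real.rpow_sub_one hu.ne']
  calc _ = (1 + q * (v / u - 1)) * u ^ q - u ^ q := by field_simp; ring
    _ ≤ _ := by linarith

/-- `∑_{a ≤ y} a ^ (p - 1) = y ^ p / p + K + O(y ^ (p - 1))` uniformly in `0 < p < 1`, where
`-1 / p ≤ K ≤ 1 - 1 / p`. (The constant `K` is `ζ(1 - p)`, but only these bounds matter.) -/
lemma exists_abs_sum_rpow_sub_one_sub_le {p : ℝ} (hp0 : 0 < p) (hp1 : p < 1) :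
    ∃ K : ℝ, -(1 / p) ≤ K ∧ K ≤ 1 - 1 / p ∧ ∀ y : ℝ, 1 ≤ y →
      |∑ a ∈ Finset.Icc 1 ⌊y⌋₊, (a : ℝ) ^ (p - 1) - (y ^ p / p + K)| ≤ 2 * y ^ (p - 1) := by
  -- Compare the sum with `y ^ p / p`: the difference decreases along the integers, and it
  -- increases once the last term is removed; `K` is the common limit.
  set z : ℕ → ℝ := fun n ↦ ∑ a ∈ Finset.Icc 1 (n + 1), (a : ℝ) ^ (p - 1) - ((n : ℝ) + 1) ^ p / p
    with hz
  set w : ℕ → ℝ := fun n ↦ z n - ((n : ℝ) + 1) ^ (p - 1) with hw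
  have hzs : ∀ n : ℕ, z (n + 1) = z n + ((n : ℝ) + 2) ^ (p - 1) -
      (((n : ℝ) + 2) ^ p - ((n : ℝ) + 1) ^ p) / p := by
    intro n
    simp only [hz]
    rw [Finset.sum_Icc_succ_top (by lia)]
    push_cast
    rw [show (n : ℝ) + 1 + 1 = n + 2 by ring]
    ring
  have hanti : Antitone z := antitone_nat_of_succ_le fun n ↦ by
    rw [hzs]
    have h := rpow_sub_rpow_le hp0.le hp1.le (u := (n : ℝ) + 2) (v := (n : ℝ) + 1)
      (by positivity) (by positivity)
    have : ((n : ℝ) + 2) ^ (p - 1) ≤ (((n : ℝ) + 2) ^ p - ((n : ℝ) + 1) ^ p) / p := by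
      rw [le_div_iff₀ hp0]; linarith
    linarith
  have hmono : Monotone w := monotone_nat_of_le_succ fun n ↦ by
    simp only [hw]
    rw [hzs]
    have h := rpow_sub_rpow_le hp0.le hp1.le (u := (n : ℝ) + 1) (v := (n : ℝ) + 2)
      (by positivity) (by positivity)
    have : (((n : ℝ) + 2) ^ p - ((n : ℝ) + 1) ^ p) / p ≤ ((n : ℝ) + 1) ^ (p - 1) := by
      rw [div_le_iff₀ hp0]; linarith
    push_cast
    rw [show (n : ℝ) + 1 + 1 = n + 2 by ring]
    linarith
  have hle : w ≤ z := fun n ↦ by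
    have : (0 : ℝ) ≤ ((n : ℝ) + 1) ^ (p - 1) := by positivity
    simp only [hw]; linarith
  have hK := Monotone.ciSup_mem_iInter_Icc_of_antitone hmono hanti hle
  rw [Set.mem_iInter] at hK
  refine ⟨⨆ n, w n, ?_, ?_, fun y hy ↦ ?_⟩
  · have := (hK 0).1
    simpa [hw, hz] using this
  · have := (hK 0).2
    simpa [hz] using this
  · obtain ⟨n, hn⟩ : ∃ n, ⌊y⌋₊ = n + 1 :=
      Nat.exists_eq_add_one.mpr (Nat.floor_pos.mpr hy)
    have h1 : (n : ℝ) + 1 ≤ y := by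
      have := Nat.floor_le (zero_le_one.trans hy); rw [hn] at this; exact_mod_cast this
    have h2 : y < (n : ℝ) + 2 := by
      have := Nat.lt_floor_add_one y; rw [hn] at this; push_cast at this; linarith
    have h3 := hK n
    have h4 : ((n : ℝ) + 1) ^ (p - 1) ≤ 2 * y ^ (p - 1) := by
      have h5 : (y / 2) ^ (p - 1) = 2 ^ (1 - p) * y ^ (p - 1) := by
        rw [Real.div_rpow (by linarith) (by norm_num), div_eq_inv_mul, ← Real.rpow_neg (by norm_num)]
        ring_nf
      calc ((n : ℝ) + 1) ^ (p - 1) ≤ (y / 2) ^ (p - 1) :=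
            Real.rpow_le_rpow_of_nonpos (by linarith)
              (by have : (0 : ℝ) ≤ n := n.cast_nonneg
                  linarith) (by linarith)
        _ = 2 ^ (1 - p) * y ^ (p - 1) := h5
        _ ≤ 2 ^ (1 : ℝ) * y ^ (p - 1) := by
          gcongr
          · norm_num
          · linarith
        _ = _ := by rw [Real.rpow_one]
    have h6 : (y ^ p - ((n : ℝ) + 1) ^ p) / p ≤ ((n : ℝ) + 1) ^ (p - 1) := by
      rw [div_le_iff₀ hp0]
      have h := rpow_sub_rpow_le hp0.le hp1.le (u := (n : ℝ) + 1) (v := y)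
        (by positivity) (by positivity)
      have : p * ((n : ℝ) + 1) ^ (p - 1) * (y - (n + 1)) ≤ p * ((n : ℝ) + 1) ^ (p - 1) * 1 := by
        gcongr; linarith
      linarith
    have h7 : 0 ≤ (y ^ p - ((n : ℝ) + 1) ^ p) / p := by
      apply div_nonneg _ hp0.le
      rw [sub_nonneg]
      gcongr
    have h8 : ∑ a ∈ Finset.Icc 1 ⌊y⌋₊, (a : ℝ) ^ (p - 1) =
        z n + ((n : ℝ) + 1) ^ p / p := by
      simp [hz, hn]
    have h9 := h3.1
    have h10 := h3.2
    simp only [hw] at h9 h10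
    rw [sub_div] at h6 h7
    rw [h8, abs_le]
    constructor <;> linarith

/-- `∑_{a ≤ y} a ^ p = y ^ (p + 1) / (p + 1) + O(y ^ p)` uniformly in `0 ≤ p`. -/
lemma abs_sum_rpow_sub_le {p y : ℝ} (hp0 : 0 ≤ p) (hy : 1 ≤ y) :
    |∑ a ∈ Finset.Icc 1 ⌊y⌋₊, (a : ℝ) ^ p - y ^ (p + 1) / (p + 1)| ≤ 2 * y ^ p := by
  have hq : 0 < p + 1 := by linarith
  have hup : ∀ n : ℕ, ∑ a ∈ Finset.Icc 1 n, (a : ℝ) ^ p ≤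
      (((n : ℝ) + 1) ^ (p + 1)) / (p + 1) - 1 / (p + 1) := by
    intro n
    induction n with
    | zero => simp
    | succ n ih =>
      rw [Finset.sum_Icc_succ_top (by lia)]
      have h := le_rpow_sub_rpow (q := p + 1) (by linarith) (u := (n : ℝ) + 1) (v := (n : ℝ) + 2)
        (by positivity) (by positivity)
      rw [add_sub_cancel_right] at h
      have : ((n : ℝ) + 1) ^ p ≤ (((n : ℝ) + 2) ^ (p + 1) - ((n : ℝ) + 1) ^ (p + 1)) / (p + 1) := by
        rw [le_div_iff₀ hq]; linarith
      push_cast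
      rw [show (n : ℝ) + 1 + 1 = n + 2 by ring]
      rw [sub_div] at this
      linarith
  have hlow : ∀ n : ℕ, (n : ℝ) ^ (p + 1) / (p + 1) ≤ ∑ a ∈ Finset.Icc 1 n, (a : ℝ) ^ p := by
    intro n
    induction n with
    | zero => simp [Real.zero_rpow hq.ne']
    | succ n ih =>
      rw [Finset.sum_Icc_succ_top (by lia)]
      have h := le_rpow_sub_rpow (q := p + 1) (by linarith) (u := (n : ℝ) + 1) (v := (n : ℝ))
        (by positivity) (by positivity)
      rw [add_sub_cancel_right] at h
      have : (((n : ℝ) + 1) ^ (p + 1) - (n : ℝ) ^ (p + 1)) / (p + 1) ≤ ((n : ℝ) + 1) ^ p := by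
        rw [div_le_iff₀ hq]; linarith
      push_cast
      rw [sub_div] at this
      linarith
  set n := ⌊y⌋₊ with hn
  have hy0 : 0 < y := by linarith
  have h1 : (n : ℝ) ≤ y := Nat.floor_le hy0.le
  have h2 : y < (n : ℝ) + 1 := Nat.lt_floor_add_one y
  have h3 : ∀ v : ℝ, y - 1 ≤ v → 0 ≤ v →
      y ^ (p + 1) / (p + 1) - y ^ p ≤ v ^ (p + 1) / (p + 1) := by
    intro v hv hv0
    have h := le_rpow_sub_rpow (q := p + 1) (by linarith) hy0 hv0
    rw [add_sub_cancel_right] at h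
    have h5 : (p + 1) * y ^ p * (-1) ≤ (p + 1) * y ^ p * (v - y) := by
      gcongr; linarith
    rw [← sub_nonneg, show v ^ (p + 1) / (p + 1) - (y ^ (p + 1) / (p + 1) - y ^ p) =
      (v ^ (p + 1) - y ^ (p + 1) + (p + 1) * y ^ p) / (p + 1) by field_simp; ring]
    apply div_nonneg _ hq.le
    linarith
  have h4 : ∑ a ∈ Finset.Icc 1 n, (a : ℝ) ^ p ≤ y ^ (p + 1) / (p + 1) + y ^ p := by
    have hn1 : 1 ≤ n := Nat.floor_pos.mpr hy
    obtain ⟨m, hm⟩ : ∃ m, n = m + 1 := Nat.exists_eq_add_one.mpr hn1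
    rw [hm] at h1 ⊢
    rw [Finset.sum_Icc_succ_top (by lia)]
    have h5 := hup m
    have h6 : ((m + 1 : ℕ) : ℝ) ^ p ≤ y ^ p := by gcongr
    have h7 : ((m : ℝ) + 1) ^ (p + 1) ≤ y ^ (p + 1) := by
      push_cast at h1
      gcongr
    have h8 : 0 ≤ 1 / (p + 1) := by positivity
    have h9 : ((m : ℝ) + 1) ^ (p + 1) / (p + 1) ≤ y ^ (p + 1) / (p + 1) := by gcongr
    linarith
  have h10 := hlow n
  have h11 := h3 n (by linarith) n.cast_nonneg
  have h12 : 0 ≤ y ^ p := by positivity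
  rw [abs_le]
  constructor <;> linarith

/-! ### The smoothed sum as an integral -/

/-- Opening `oneConvChar` into a sum over factorizations `n = a * b`. -/
lemma sum_oneConvChar_mul {D : ℕ} (χ : DirichletCharacter ℝ D) (F : ℕ → ℝ) (N : ℕ) :
    ∑ n ∈ Finset.Icc 1 N, oneConvChar χ n * F n =
      ∑ a ∈ Finset.Icc 1 N, ∑ b ∈ Finset.Icc 1 (N / a), F (a * b) * χ (b : ZMod D) := by
  simp_rw [oneConvChar, Finset.sum_mul]
  rw [Finset.sum_sigma', Finset.sum_sigma']
  refine Finset.sum_nbij' (fun z ↦ ⟨z.1 / z.2, z.2⟩) (fun z ↦ ⟨z.1 * z.2, z.2⟩) ?_ ?_ ?_ ?_ ?_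
  · rintro ⟨n, d⟩ h
    simp only [Finset.mem_sigma, Finset.mem_Icc, Nat.mem_divisors] at h ⊢
    obtain ⟨⟨hn1, hnN⟩, hdn, hn0⟩ := h
    obtain ⟨a, rfl⟩ := hdn
    have hd : 0 < d := Nat.pos_of_ne_zero fun h ↦ hn0 (by simp [h])
    have ha : 0 < a := Nat.pos_of_ne_zero fun h ↦ hn0 (by simp [h])
    rw [Nat.mul_div_cancel_left _ hd]
    refine ⟨⟨ha, ?_⟩, hd, ?_⟩
    · exact (Nat.le_mul_of_pos_left a hd).trans hnN
    · rwa [Nat.le_div_iff_mul_le ha]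
  · rintro ⟨a, b⟩ h
    simp only [Finset.mem_sigma, Finset.mem_Icc, Nat.mem_divisors] at h ⊢
    obtain ⟨⟨ha, _⟩, hb, hbN⟩ := h
    rw [Nat.le_div_iff_mul_le ha, mul_comm] at hbN
    exact ⟨⟨Nat.mul_pos ha hb, hbN⟩, dvd_mul_left _ _, (Nat.mul_pos ha hb).ne'⟩
  · rintro ⟨n, d⟩ h
    simp only [Finset.mem_sigma, Finset.mem_Icc, Nat.mem_divisors] at h ⊢
    rw [Nat.div_mul_cancel h.2.1]
  · rintro ⟨a, b⟩ h
    simp only [Finset.mem_sigma, Finset.mem_Icc] at h ⊢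
    rw [Nat.mul_div_cancel _ h.2.1]
  · rintro ⟨n, d⟩ h
    simp only [Finset.mem_sigma, Finset.mem_Icc, Nat.mem_divisors] at h ⊢
    rw [Nat.div_mul_cancel h.2.1, mul_comm]

lemma integrableOn_charSum_mul {D : ℕ} {χ : DirichletCharacter ℝ D} {M : ℝ}
    (hM : ∀ t, |charSum χ t| ≤ M) {g : ℝ → ℝ} {s : Set ℝ} (hg : IntegrableOn g s) :
    IntegrableOn (fun t ↦ charSum χ t * g t) s :=
  hg.bdd_mul (measurable_charSum χ).aestronglyMeasurable (ae_of_all _ hM)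

/-- Partial summation for one of the inner sums of `smoothedSum`. There is no boundary term, since
the weight vanishes at the end point `t = x / a`. -/
lemma sum_weight_mul_eq_integral {D : ℕ} {χ : DirichletCharacter ℝ D} (hD : 1 < D)
    {β x a : ℝ} (hx : 0 < x) (ha : 0 < a) :
    ∑ b ∈ Finset.Icc 1 ⌊x / a⌋₊, ((1 - a * b / x) * (a * b) ^ (-β)) * χ (b : ZMod D) =
      ∫ t in Set.Ioc 1 (x / a),
        charSum χ t * (t ^ (-(β + 1)) * (a ^ (-β) * (β + (1 - β) * (a / (x / t))))) := by
  have : Fact (1 < D) := ⟨hD⟩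
  have hc : χ ((0 : ℕ) : ZMod D) = 0 := by
    rw [Nat.cast_zero]
    exact MulChar.map_nonunit _ not_isUnit_zero
  have hIcc : ∀ (n : ℕ) (g : ℕ → ℝ), g 0 = 0 →
      ∑ k ∈ Finset.Icc 0 n, g k = ∑ k ∈ Finset.Icc 1 n, g k := fun n g hg ↦ by
    rw [← Finset.insert_Icc_add_one_left_eq_Icc n.zero_le, Finset.sum_insert (by simp), hg,
      zero_add, zero_add]
  set f : ℝ → ℝ := fun t ↦ a ^ (-β) * (t ^ (-β) - a / x * t ^ (1 - β)) with hf
  have hderiv : ∀ t : ℝ, 0 < t → HasDerivAt f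
      (-(t ^ (-(β + 1)) * (a ^ (-β) * (β + (1 - β) * (a / (x / t)))))) t := fun t ht ↦ by
    have h1 := ((Real.hasDerivAt_rpow_const (p := -β) (Or.inl ht.ne')).sub
      ((Real.hasDerivAt_rpow_const (p := 1 - β) (Or.inl ht.ne')).const_mul (a / x))).const_mul
        (a ^ (-β))
    refine h1.congr_deriv ?_
    have h2 : t ^ (1 - β - 1) = t ^ (-(β + 1)) * t := by
      rw [← Real.rpow_add_one ht.ne']; ring_nf
    rw [h2, show -β - 1 = -(β + 1) by ring]
    field_simp
    ring
  have hcont : ContinuousOn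
      (fun t : ℝ ↦ -(t ^ (-(β + 1)) * (a ^ (-β) * (β + (1 - β) * (a / (x / t))))))
      (Set.Icc 1 (x / a)) := by
    have h0 : ∀ t ∈ Set.Icc 1 (x / a), t ≠ 0 := fun t ht ↦ by linarith [ht.1]
    have h1 : ∀ t ∈ Set.Icc 1 (x / a), x / t ≠ 0 := fun t ht ↦ div_ne_zero hx.ne' (h0 t ht)
    have h2 : ContinuousOn (fun t : ℝ ↦ t ^ (-(β + 1))) (Set.Icc 1 (x / a)) :=
      continuousOn_id.rpow_const fun t ht ↦ Or.inl (h0 t ht)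
    have h3 : ContinuousOn (fun t : ℝ ↦ x / t) (Set.Icc 1 (x / a)) :=
      continuousOn_const.div continuousOn_id h0
    have h4 : ContinuousOn (fun t : ℝ ↦ a / (x / t)) (Set.Icc 1 (x / a)) :=
      continuousOn_const.div h3 h1
    fun_prop
  have hpos : ∀ t ∈ Set.Icc 1 (x / a), 0 < t := fun t ht ↦ zero_lt_one.trans_le ht.1
  have habel := sum_mul_eq_sub_integral_mul₀ (𝕜 := ℝ) (f := f) (fun k : ℕ ↦ χ (k : ZMod D)) hc (x / a)
    (fun t ht ↦ (hderiv t (hpos t ht)).differentiableAt)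
    ((hcont.integrableOn_Icc).congr_fun
      (fun t ht ↦ ((hderiv t (hpos t ht)).deriv).symm) measurableSet_Icc)
  have hend : f (x / a) = 0 := by
    have h1 : (x / a) ^ (1 - β) = (x / a) ^ (-β) * (x / a) := by
      rw [← Real.rpow_add_one (by positivity)]; ring_nf
    simp only [hf]
    rw [h1]
    field_simp
    ring
  rw [hend, zero_mul, zero_sub, hIcc _ _ (by rw [hc, mul_zero]), ← integral_neg] at habel
  have hsum : ∑ b ∈ Finset.Icc 1 ⌊x / a⌋₊,
      ((1 - a * b / x) * (a * b) ^ (-β)) * χ (b : ZMod D) =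
      ∑ b ∈ Finset.Icc 1 ⌊x / a⌋₊, f b * χ (b : ZMod D) := by
    refine Finset.sum_congr rfl fun b hb ↦ ?_
    have hb0 : (0 : ℝ) < b := by exact_mod_cast (Finset.mem_Icc.mp hb).1
    have h1 : (b : ℝ) ^ (1 - β) = (b : ℝ) ^ (-β) * b := by
      rw [← Real.rpow_add_one hb0.ne']; ring_nf
    simp only [hf]
    rw [h1, Real.mul_rpow ha.le hb0.le]
    ring
  rw [hsum, habel]
  refine setIntegral_congr_fun measurableSet_Ioc fun t ht ↦ ?_
  have ht0 : 0 < t := zero_lt_one.trans ht.1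
  rw [(hderiv t ht0).deriv, hIcc _ _ hc, charSum]
  ring

/-- The smoothed sum as an integral of the character sum against a kernel of power sums. -/
lemma smoothedSum_eq_integral {D : ℕ} {χ : DirichletCharacter ℝ D} (hD : 1 < D) {M : ℝ}
    (hM : ∀ t, |charSum χ t| ≤ M) {β x : ℝ} (hx : 1 ≤ x) :
    IntegrableOn (fun t ↦ charSum χ t * (t ^ (-(β + 1)) *
      ∑ a ∈ Finset.Icc 1 ⌊x / t⌋₊, (a : ℝ) ^ (-β) * (β + (1 - β) * (a / (x / t)))))
      (Set.Ioc 1 x) ∧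
    smoothedSum χ β x = ∫ t in Set.Ioc 1 x, charSum χ t * (t ^ (-(β + 1)) *
      ∑ a ∈ Finset.Icc 1 ⌊x / t⌋₊, (a : ℝ) ^ (-β) * (β + (1 - β) * (a / (x / t)))) := by
  have hx0 : 0 < x := by linarith
  set g : ℕ → ℝ → ℝ := fun a t ↦
    charSum χ t * (t ^ (-(β + 1)) * ((a : ℝ) ^ (-β) * (β + (1 - β) * (a / (x / t))))) with hg
  have hgint : ∀ a : ℕ, IntegrableOn (g a) (Set.Ioc 1 x) := by
    intro a
    refine integrableOn_charSum_mul hM ?_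
    refine IntegrableOn.mono_set ?_ Set.Ioc_subset_Icc_self
    refine ContinuousOn.integrableOn_Icc ?_
    have h0 : ∀ t ∈ Set.Icc 1 x, t ≠ 0 := fun t ht ↦ by linarith [ht.1]
    have h1 : ∀ t ∈ Set.Icc 1 x, x / t ≠ 0 := fun t ht ↦ div_ne_zero hx0.ne' (h0 t ht)
    have h2 : ContinuousOn (fun t : ℝ ↦ t ^ (-(β + 1))) (Set.Icc 1 x) :=
      continuousOn_id.rpow_const fun t ht ↦ Or.inl (h0 t ht)
    have h3 : ContinuousOn (fun t : ℝ ↦ x / t) (Set.Icc 1 x) :=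
      continuousOn_const.div continuousOn_id h0
    have h4 : ContinuousOn (fun t : ℝ ↦ (a : ℝ) / (x / t)) (Set.Icc 1 x) :=
      continuousOn_const.div h3 h1
    fun_prop
  have hind : ∀ a : ℕ, IntegrableOn ((Set.Iic (x / a)).indicator (g a)) (Set.Ioc 1 x) :=
    fun a ↦ (hgint a).indicator measurableSet_Iic
  have hpoint : ∀ t ∈ Set.Ioc 1 x,
      ∑ a ∈ Finset.Icc 1 ⌊x⌋₊, (Set.Iic (x / a)).indicator (g a) t =
      charSum χ t * (t ^ (-(β + 1)) *
      ∑ a ∈ Finset.Icc 1 ⌊x / t⌋₊, (a : ℝ) ^ (-β) * (β + (1 - β) * (a / (x / t)))) := by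
    intro t ht
    have ht0 : 0 < t := zero_lt_one.trans ht.1
    simp_rw [Set.indicator_apply]
    rw [← Finset.sum_filter, Finset.mul_sum, Finset.mul_sum]
    refine Finset.sum_congr ?_ fun a _ ↦ rfl
    ext a
    simp only [Finset.mem_filter, Finset.mem_Icc, Set.mem_Iic]
    rw [Nat.le_floor_iff hx0.le, Nat.le_floor_iff (by positivity)]
    constructor
    · rintro ⟨⟨h1, _⟩, h2⟩
      have ha : (0 : ℝ) < a := by exact_mod_cast h1
      refine ⟨h1, ?_⟩
      rw [le_div_iff₀ ha] at h2
      rw [le_div_iff₀ ht0]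
      linarith
    · rintro ⟨h1, h2⟩
      have ha : (0 : ℝ) < a := by exact_mod_cast h1
      refine ⟨⟨h1, h2.trans (div_le_self hx0.le ht.1.le)⟩, ?_⟩
      rw [le_div_iff₀ ht0] at h2
      rw [le_div_iff₀ ha]
      linarith
  constructor
  · refine IntegrableOn.congr_fun ?_ hpoint measurableSet_Ioc
    exact integrable_finsetSum _ fun a _ ↦ hind a
  · rw [← setIntegral_congr_fun measurableSet_Ioc hpoint, integral_finsetSum _ fun a _ ↦ hind a]
    have h1 := sum_oneConvChar_mul χ (fun n ↦ (1 - (n : ℝ) / x) * (n : ℝ) ^ (-β)) ⌊x⌋₊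
    rw [smoothedSum]
    simp_rw [mul_assoc]
    rw [h1]
    refine Finset.sum_congr rfl fun a ha ↦ ?_
    have ha0 : (0 : ℝ) < a := by exact_mod_cast (Finset.mem_Icc.mp ha).1
    have ha1 : (1 : ℝ) ≤ a := by exact_mod_cast (Finset.mem_Icc.mp ha).1
    rw [setIntegral_indicator measurableSet_Iic, Set.Ioc_inter_Iic,
      min_eq_right (div_le_self hx0.le ha1), ← Nat.floor_div_natCast]
    have h2 := sum_weight_mul_eq_integral (χ := χ) hD (β := β) hx0 ha0
    push_cast
    exact h2

/-! ### The asymptotic formula for the smoothed sum -/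

/-- The kernel `∑_{a ≤ y} a ^ (-β) (β + (1 - β) a / y)` agrees up to `O(y ^ (-β))` with
`R(y) = y ^ (1 - β) / ((1 - β) (2 - β)) + β K`. For `y ≤ 1`, where the kernel vanishes, `R(y)`
stays small uniformly in `β`: as `β → 1` its two terms nearly cancel. -/
lemma exists_abs_kernel_sub_le {β : ℝ} (hβ0 : 0 < β) (hβ1 : β < 1) :
    ∃ K : ℝ,
      (∀ y : ℝ, 1 ≤ y →
        |∑ a ∈ Finset.Icc 1 ⌊y⌋₊, (a : ℝ) ^ (-β) * (β + (1 - β) * (a / y)) -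
          (y ^ (1 - β) / ((1 - β) * (2 - β)) + β * K)| ≤ 4 * y ^ (-β)) ∧
      ∀ y : ℝ, 0 < y → y ≤ 1 →
        |y ^ (1 - β) / ((1 - β) * (2 - β)) + β * K| ≤ 4 * y ^ (-(1 / 2 : ℝ)) := by
  obtain ⟨K, hK0, hK1, hK⟩ :=
    exists_abs_sum_rpow_sub_one_sub_le (p := 1 - β) (by linarith) (by linarith)
  have hp : 0 < 1 - β := by linarith
  have hq : 0 < 2 - β := by linarith
  refine ⟨K, fun y hy ↦ ?_, fun y hy0 hy1 ↦ ?_⟩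
  · have hy0 : 0 < y := by linarith
    have h1 := hK y hy
    have h2 := abs_sum_rpow_sub_le hp.le hy
    rw [show 1 - β - 1 = -β by ring] at h1
    rw [show 1 - β + 1 = 2 - β by ring] at h2
    have hyq : y ^ (2 - β) = y ^ (1 - β) * y := by
      rw [← Real.rpow_add_one hy0.ne']; ring_nf
    have hyp : y ^ (1 - β) = y ^ (-β) * y := by
      rw [← Real.rpow_add_one hy0.ne']; ring_nf
    have hsum : ∑ a ∈ Finset.Icc 1 ⌊y⌋₊, (a : ℝ) ^ (-β) * (β + (1 - β) * (a / y)) =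
        β * ∑ a ∈ Finset.Icc 1 ⌊y⌋₊, (a : ℝ) ^ (-β) +
        (1 - β) / y * ∑ a ∈ Finset.Icc 1 ⌊y⌋₊, (a : ℝ) ^ (1 - β) := by
      rw [Finset.mul_sum, Finset.mul_sum, ← Finset.sum_add_distrib]
      refine Finset.sum_congr rfl fun a ha ↦ ?_
      have ha0 : (0 : ℝ) < a := by exact_mod_cast (Finset.mem_Icc.mp ha).1
      have : (a : ℝ) ^ (1 - β) = (a : ℝ) ^ (-β) * a := by
        rw [← Real.rpow_add_one ha0.ne']; ring_nf
      rw [this]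
      field_simp
    set Z := ∑ a ∈ Finset.Icc 1 ⌊y⌋₊, (a : ℝ) ^ (-β)
    set W := ∑ a ∈ Finset.Icc 1 ⌊y⌋₊, (a : ℝ) ^ (1 - β)
    have hdec : β * Z + (1 - β) / y * W - (y ^ (1 - β) / ((1 - β) * (2 - β)) + β * K) =
        β * (Z - (y ^ (1 - β) / (1 - β) + K)) + (1 - β) / y * (W - y ^ (2 - β) / (2 - β)) := by
      rw [hyq]
      field_simp
      ring
    rw [hsum, hdec]
    calc _ ≤ |β * (Z - (y ^ (1 - β) / (1 - β) + K))| +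
          |(1 - β) / y * (W - y ^ (2 - β) / (2 - β))| := abs_add_le _ _
      _ = β * |Z - (y ^ (1 - β) / (1 - β) + K)| +
          (1 - β) / y * |W - y ^ (2 - β) / (2 - β)| := by
        rw [abs_mul, abs_mul, abs_of_pos hβ0, abs_of_pos (div_pos hp hy0)]
      _ ≤ β * (2 * y ^ (-β)) + (1 - β) / y * (2 * y ^ (1 - β)) := by gcongr
      _ = 2 * y ^ (-β) := by rw [hyp]; field_simp; ring
      _ ≤ 4 * y ^ (-β) := by
        have : 0 ≤ y ^ (-β) := by positivity
        linarith
  · have hlog : -Real.log y ≤ 2 * y ^ (-(1 / 2 : ℝ)) := by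
      have := Real.log_le_rpow_div (x := y⁻¹) (ε := 1 / 2) (by positivity) (by norm_num)
      rw [Real.log_inv, Real.inv_rpow hy0.le, ← Real.rpow_neg hy0.le] at this
      linarith
    have hone : 1 ≤ y ^ (-(1 / 2 : ℝ)) := Real.one_le_rpow_of_pos_of_le_one_of_nonpos hy0 hy1
      (by norm_num)
    have hyp1 : y ^ (1 - β) ≤ 1 := Real.rpow_le_one hy0.le hy1 hp.le
    have hyp2 : 1 - y ^ (1 - β) ≤ (1 - β) * (-Real.log y) := by
      rw [Real.rpow_def_of_pos hy0]
      have := Real.add_one_le_exp (Real.log y * (1 - β))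
      linarith
    have hpq : 0 < (1 - β) * (2 - β) := mul_pos hp hq
    have hdec : y ^ (1 - β) / ((1 - β) * (2 - β)) + β * K =
        -((1 - y ^ (1 - β)) / ((1 - β) * (2 - β))) + (1 - β) / (2 - β) + β * (K + 1 / (1 - β)) := by
      field_simp
      ring
    have h1 : 0 ≤ (1 - y ^ (1 - β)) / ((1 - β) * (2 - β)) :=
      div_nonneg (by linarith) hpq.le
    have h2 : (1 - y ^ (1 - β)) / ((1 - β) * (2 - β)) ≤ -Real.log y := by
      rw [div_le_iff₀ hpq]
      have : 0 ≤ -Real.log y := by linarith [Real.log_nonpos hy0.le hy1]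
      nlinarith [mul_nonneg this (mul_nonneg hp.le hp.le)]
    have h3 : 0 ≤ (1 - β) / (2 - β) := by positivity
    have h4 : (1 - β) / (2 - β) ≤ 1 := by rw [div_le_one hq]; linarith
    have h5 : 0 ≤ β * (K + 1 / (1 - β)) := mul_nonneg hβ0.le (by linarith)
    have h6 : β * (K + 1 / (1 - β)) ≤ 1 := by
      calc _ ≤ β * 1 := by gcongr; linarith
        _ ≤ 1 := by linarith
    rw [hdec, abs_le]
    constructor <;> linarith

/-- If `β` is a zero of the `L`-function, the smoothed sum equals its main term
`L(1, χ) x ^ (1 - β) / ((1 - β) (2 - β))` up to an error of the size of the character sums times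
`x ^ (-β) log x`. -/
theorem abs_smoothedSum_sub_le {D : ℕ} [NeZero D] {χ : DirichletCharacter ℝ D}
    (hχ : χ.IsPrimitive) (hD : 1 < D) {M : ℝ} (hM : ∀ t, |charSum χ t| ≤ M) {β x : ℝ}
    (hβ0 : 2 / 3 ≤ β) (hβ1 : β < 1) (hzero : realCharLFunction χ β = 0) (hx : 1 ≤ x) :
    |smoothedSum χ β x -
      (realCharLFunction χ 1).re * (x ^ (1 - β) / ((1 - β) * (2 - β)))| ≤
      M * x ^ (-β) * (4 * Real.log x + 24) := by
  have hx0 : 0 < x := by linarith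
  have hM0 : 0 ≤ M := (abs_nonneg _).trans (hM 0)
  obtain ⟨K, hK1, hK2⟩ := exists_abs_kernel_sub_le (β := β) (by linarith) hβ1
  obtain ⟨hHint, hS⟩ := smoothedSum_eq_integral hD hM (β := β) hx
  have hL1 : (realCharLFunction χ 1).re =
      ∫ t in Set.Ioi (1 : ℝ), charSum χ t * t ^ (-(1 + 1) : ℝ) := by
    have := realCharLFunction_ofReal hχ hD one_pos
    rw [Complex.ofReal_one] at this
    rw [this, Complex.ofReal_re, one_mul]
  have hLβ : ∫ t in Set.Ioi (1 : ℝ), charSum χ t * t ^ (-(β + 1)) = 0 := by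
    rw [realCharLFunction_ofReal hχ hD (by linarith), Complex.ofReal_eq_zero] at hzero
    exact (mul_eq_zero.mp hzero).resolve_left (by linarith)
  set H : ℝ → ℝ := fun y ↦
    ∑ a ∈ Finset.Icc 1 ⌊y⌋₊, (a : ℝ) ^ (-β) * (β + (1 - β) * (a / y)) with hH
  set R : ℝ → ℝ := fun y ↦ y ^ (1 - β) / ((1 - β) * (2 - β)) + β * K with hR
  set c : ℝ := x ^ (1 - β) / ((1 - β) * (2 - β)) with hc
  have hRt : ∀ t ∈ Set.Ioi (1 : ℝ), charSum χ t * (t ^ (-(β + 1)) * R (x / t)) =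
      c * (charSum χ t * t ^ (-(1 + 1) : ℝ)) + β * K * (charSum χ t * t ^ (-(β + 1))) := by
    intro t ht
    have ht0 : 0 < t := zero_lt_one.trans ht
    have h1 : t ^ (-(β + 1)) = t ^ (-(1 + 1) : ℝ) * t ^ (1 - β) := by
      rw [← Real.rpow_add ht0]; ring_nf
    have h2 : t ^ (1 - β) ≠ 0 := (Real.rpow_pos_of_pos ht0 _).ne'
    have h3 : t ^ (-(β + 1)) * (x / t) ^ (1 - β) = t ^ (-(1 + 1) : ℝ) * x ^ (1 - β) := by
      rw [Real.div_rpow hx0.le ht0.le, h1]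
      field_simp
    simp only [hR, hc]
    linear_combination charSum χ t / ((1 - β) * (2 - β)) * h3
  have hint1 : IntegrableOn (fun t ↦ charSum χ t * t ^ (-(1 + 1) : ℝ)) (Set.Ioi 1) :=
    integrableOn_charSum_mul hM (integrableOn_Ioi_rpow_of_lt (by norm_num) one_pos)
  have hintβ : IntegrableOn (fun t ↦ charSum χ t * t ^ (-(β + 1))) (Set.Ioi 1) :=
    integrableOn_charSum_mul hM (integrableOn_Ioi_rpow_of_lt (by linarith) one_pos)
  have hRint : IntegrableOn (fun t ↦ charSum χ t * (t ^ (-(β + 1)) * R (x / t))) (Set.Ioi 1) :=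
    IntegrableOn.congr_fun ((hint1.const_mul c).add (hintβ.const_mul (β * K)))
      (fun t ht ↦ (hRt t ht).symm) measurableSet_Ioi
  have hmain : ∫ t in Set.Ioi (1 : ℝ), charSum χ t * (t ^ (-(β + 1)) * R (x / t)) =
      (realCharLFunction χ 1).re * c := by
    rw [setIntegral_congr_fun measurableSet_Ioi hRt,
      integral_add (hint1.const_mul c) (hintβ.const_mul (β * K)), integral_const_mul,
      integral_const_mul, hLβ, ← hL1]
    ring
  have hsplit : ∫ t in Set.Ioi (1 : ℝ), charSum χ t * (t ^ (-(β + 1)) * R (x / t)) =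
      (∫ t in Set.Ioc 1 x, charSum χ t * (t ^ (-(β + 1)) * R (x / t))) +
        ∫ t in Set.Ioi x, charSum χ t * (t ^ (-(β + 1)) * R (x / t)) := by
    rw [← Set.Ioc_union_Ioi_eq_Ioi hx]
    exact setIntegral_union (Set.Ioc_disjoint_Ioi le_rfl) measurableSet_Ioi
      (hRint.mono_set Set.Ioc_subset_Ioi_self) (hRint.mono_set (Set.Ioi_subset_Ioi hx))
  have hdiff : smoothedSum χ β x - (realCharLFunction χ 1).re * c =
      (∫ t in Set.Ioc 1 x, charSum χ t * (t ^ (-(β + 1)) * (H (x / t) - R (x / t)))) -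
        ∫ t in Set.Ioi x, charSum χ t * (t ^ (-(β + 1)) * R (x / t)) := by
    have h1 := integral_sub hHint (hRint.mono_set Set.Ioc_subset_Ioi_self)
    rw [← hmain, hsplit, hS]
    simp only [mul_sub]
    rw [← sub_sub]
    exact congrArg (· - _) h1.symm
  have hE1 : |∫ t in Set.Ioc 1 x, charSum χ t * (t ^ (-(β + 1)) * (H (x / t) - R (x / t)))| ≤
      M * x ^ (-β) * (4 * Real.log x) := by
    have hbound : ∀ t ∈ Set.Ioc 1 x,
        ‖charSum χ t * (t ^ (-(β + 1)) * (H (x / t) - R (x / t)))‖ ≤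
          4 * M * x ^ (-β) * t⁻¹ := by
      intro t ht
      have ht0 : 0 < t := zero_lt_one.trans ht.1
      have h1 := hK1 (x / t) (by rw [le_div_iff₀ ht0, one_mul]; exact ht.2)
      rw [norm_mul, norm_mul, Real.norm_of_nonneg (by positivity : 0 ≤ t ^ (-(β + 1)))]
      calc _ ≤ M * (t ^ (-(β + 1)) * (4 * (x / t) ^ (-β))) := by
            gcongr
            · exact hM t
            · exact h1
        _ = _ := by
          have h2 : t ^ (-(β + 1)) = t ^ (-β) * t⁻¹ := by
            rw [← Real.rpow_neg_one t, ← Real.rpow_add ht0]; ring_nf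
          have h3 : t ^ (-β) ≠ 0 := (Real.rpow_pos_of_pos ht0 _).ne'
          rw [Real.div_rpow hx0.le ht0.le, h2]
          field_simp
    have hinv : IntegrableOn (fun t : ℝ ↦ t⁻¹) (Set.Ioc 1 x) := by
      refine IntegrableOn.mono_set (ContinuousOn.integrableOn_Icc ?_) Set.Ioc_subset_Icc_self
      exact continuousOn_id.inv₀ fun t ht ↦ by
        have := ht.1
        simp only [id]; linarith
    have hlog : ∫ t in Set.Ioc 1 x, t⁻¹ = Real.log x := by
      rw [← intervalIntegral.integral_of_le hx, integral_inv_of_pos one_pos hx0, div_one]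
    have h1 := norm_integral_le_of_norm_le (hinv.const_mul (4 * M * x ^ (-β)))
      ((ae_restrict_mem measurableSet_Ioc).mono hbound)
    rw [integral_const_mul, hlog] at h1
    rw [← Real.norm_eq_abs]
    calc _ ≤ _ := h1
      _ = _ := by ring
  have hE2 : |∫ t in Set.Ioi x, charSum χ t * (t ^ (-(β + 1)) * R (x / t))| ≤
      M * x ^ (-β) * 24 := by
    have hbound : ∀ t ∈ Set.Ioi x, ‖charSum χ t * (t ^ (-(β + 1)) * R (x / t))‖ ≤
          4 * M * x ^ (-(1 / 2) : ℝ) * t ^ (-(β + 1 / 2)) := by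
      intro t ht
      have ht0 : 0 < t := hx0.trans ht
      have h1 := hK2 (x / t) (by positivity) (by rw [div_le_one ht0]; exact le_of_lt ht)
      rw [norm_mul, norm_mul, Real.norm_of_nonneg (by positivity : 0 ≤ t ^ (-(β + 1)))]
      calc _ ≤ M * (t ^ (-(β + 1)) * (4 * (x / t) ^ (-(1 / 2) : ℝ))) := by
            gcongr
            · exact hM t
            · exact h1
        _ = _ := by
          have h2 : t ^ (-(β + 1)) = t ^ (-(β + 1 / 2)) * t ^ (-(1 / 2) : ℝ) := by
            rw [← Real.rpow_add ht0]; ring_nf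
          have h3 : t ^ (-(1 / 2) : ℝ) ≠ 0 := (Real.rpow_pos_of_pos ht0 _).ne'
          rw [Real.div_rpow hx0.le ht0.le, h2]
          field_simp
    have hr : -(β + 1 / 2) < -1 := by linarith
    have h1 := norm_integral_le_of_norm_le
      ((integrableOn_Ioi_rpow_of_lt hr hx0).const_mul (4 * M * x ^ (-(1 / 2) : ℝ)))
      ((ae_restrict_mem measurableSet_Ioi).mono hbound)
    rw [integral_const_mul, integral_Ioi_rpow_of_lt hr hx0] at h1
    rw [← Real.norm_eq_abs]
    have h2 : x ^ (-β) = x ^ (-(1 / 2) : ℝ) * x ^ (-(β + 1 / 2) + 1) := by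
      rw [← Real.rpow_add hx0]; ring_nf
    have h3 : -x ^ (-(β + 1 / 2) + 1) / (-(β + 1 / 2) + 1) =
        x ^ (-(β + 1 / 2) + 1) * (1 / (β - 1 / 2)) := by
      rw [show -(β + 1 / 2) + 1 = -(β - 1 / 2) by ring, neg_div_neg_eq]
      ring
    have h4 : 1 / (β - 1 / 2) ≤ 6 := by
      rw [div_le_iff₀ (by linarith)]; linarith
    calc _ ≤ _ := h1
      _ = M * x ^ (-β) * (4 * (1 / (β - 1 / 2))) := by rw [h2, h3]; ring
      _ ≤ M * x ^ (-β) * (4 * 6) := by gcongr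
      _ = _ := by norm_num
  rw [hdiff]
  calc _ ≤ _ := abs_sub _ _
    _ ≤ _ := add_le_add hE1 hE2
    _ = _ := by ring

/-! ### Exceptional zeros -/

/-- `β` is an exceptional zero of `χ`: the character `χ` is real primitive of conductor `D > 1`, and
`β` is a real zero of its `L`-function with `1 - β ≤ 1 / (3 log D)`. -/
structure IsExceptionalZero {D : ℕ} [NeZero D] (χ : DirichletCharacter ℝ D) (β : ℝ) : Prop where
  one_lt : 1 < D
  isPrimitive : χ.IsPrimitive
  apply_eq_zero : realCharLFunction χ β = 0
  one_sub_le : 1 - β ≤ (3 * Real.log D)⁻¹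

lemma DirichletCharacter.sq_eq_one_of_real {D : ℕ} (χ : DirichletCharacter ℝ D) :
    (χ.ringHomComp Complex.ofRealHom) ^ 2 = 1 := by
  ext u
  have h1 := DirichletCharacter.unit_norm_eq_one (χ.ringHomComp Complex.ofRealHom) u
  rw [MulChar.ringHomComp_apply, Complex.ofRealHom_eq_coe, Complex.norm_real,
    Real.norm_eq_abs] at h1
  have h2 : χ u ^ 2 = 1 := by rw [← sq_abs, h1, one_pow]
  rw [MulChar.pow_apply_coe, MulChar.ringHomComp_apply, Complex.ofRealHom_eq_coe,
    ← Complex.ofReal_pow, h2, MulChar.one_apply_coe, Complex.ofReal_one]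

section Character

variable {D : ℕ} {χ : DirichletCharacter ℝ D}

/-- The coefficients `λ(n)` agree with Mathlib's `DirichletCharacter.zetaMul`, which is nonnegative
for quadratic characters. -/
lemma oneConvChar_nonneg (χ : DirichletCharacter ℝ D) (n : ℕ) : 0 ≤ oneConvChar χ n := by
  open scoped ComplexOrder in
  have h := DirichletCharacter.zetaMul_nonneg χ.sq_eq_one_of_real n
  have h1 : DirichletCharacter.zetaMul (χ.ringHomComp Complex.ofRealHom) n =
      (oneConvChar χ n : ℂ) := by
    rw [DirichletCharacter.zetaMul, ArithmeticFunction.coe_zeta_mul_apply, oneConvChar,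
      Complex.ofReal_sum]
    refine Finset.sum_congr rfl fun d hd ↦ ?_
    have hd0 : d ≠ 0 := (Nat.pos_of_mem_divisors hd).ne'
    simp [toArithmeticFunction, hd0, MulChar.ringHomComp_apply]
  rw [h1] at h
  exact Complex.zero_le_real.mp h

/-- The term `n = 1` alone, all terms being nonnegative. -/
lemma one_sub_inv_le_smoothedSum (χ : DirichletCharacter ℝ D) (β : ℝ) {x : ℝ} (hx : 1 ≤ x) :
    1 - 1 / x ≤ smoothedSum χ β x := by
  have hx0 : 0 < x := by linarith
  have h1 : 1 ∈ Finset.Icc 1 ⌊x⌋₊ := Finset.mem_Icc.mpr ⟨le_rfl, Nat.floor_pos.mpr hx⟩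
  refine le_trans ?_ (Finset.single_le_sum (f := fun n : ℕ ↦
    oneConvChar χ n * (1 - (n : ℝ) / x) * (n : ℝ) ^ (-β)) (fun n hn ↦ ?_) h1)
  · simp [oneConvChar]
  · have : (n : ℝ) ≤ x := (Nat.le_floor_iff hx0.le).mp (Finset.mem_Icc.mp hn).2
    have h2 : 0 ≤ 1 - (n : ℝ) / x := by rw [sub_nonneg, div_le_one hx0]; exact this
    exact mul_nonneg (mul_nonneg (oneConvChar_nonneg χ n) h2) (by positivity)

lemma two_div_three_le_smoothedSum (χ : DirichletCharacter ℝ D) (β : ℝ) {x : ℝ} (hx : 3 ≤ x) :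
    2 / 3 ≤ smoothedSum χ β x := by
  refine le_trans ?_ (one_sub_inv_le_smoothedSum χ β (by linarith))
  have : 1 / x ≤ 1 / 3 := one_div_le_one_div_of_le (by norm_num) hx
  linarith

lemma smoothedSum_le_sum (χ : DirichletCharacter ℝ D) {β : ℝ} (hβ : 0 ≤ β) {x : ℝ} (hx : 0 ≤ x) :
    smoothedSum χ β x ≤ ∑ n ∈ Finset.Icc 1 ⌊x⌋₊, oneConvChar χ n := by
  refine Finset.sum_le_sum fun n hn ↦ ?_
  have hn1 : (1 : ℝ) ≤ n := by exact_mod_cast (Finset.mem_Icc.mp hn).1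
  have h1 : (n : ℝ) ^ (-β) ≤ 1 := Real.rpow_le_one_of_one_le_of_nonpos hn1 (by linarith)
  have h2 : 1 - (n : ℝ) / x ≤ 1 := by
    have : 0 ≤ (n : ℝ) / x := by positivity
    linarith
  have h3 := oneConvChar_nonneg χ n
  calc _ ≤ oneConvChar χ n * 1 * (n : ℝ) ^ (-β) := by gcongr
    _ ≤ oneConvChar χ n * 1 * 1 := by gcongr
    _ = _ := by ring

lemma realCharLFunction_one_eq_ofReal [NeZero D] (hχ : χ.IsPrimitive) (hD : 1 < D) :
    realCharLFunction χ 1 = ((realCharLFunction χ 1).re : ℂ) := by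
  have := realCharLFunction_ofReal hχ hD one_pos
  rw [Complex.ofReal_one] at this
  rw [this, Complex.ofReal_re]

/-- There is no primitive character modulo `2`. -/
lemma three_le_of_isPrimitive [NeZero D] (hχ : χ.IsPrimitive) (hD : 1 < D) : 3 ≤ D := by
  by_contra h
  obtain rfl : D = 2 := by lia
  refine hχ.ne_one hD ?_
  ext u
  rw [Subsingleton.elim u 1]
  simp

end Character

namespace IsExceptionalZero

variable {D : ℕ} [NeZero D] {χ : DirichletCharacter ℝ D} {β : ℝ}

lemma three_le (h : IsExceptionalZero χ β) : (3 : ℝ) ≤ D := by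
  exact_mod_cast three_le_of_isPrimitive h.isPrimitive h.one_lt

lemma one_lt_log (h : IsExceptionalZero χ β) : 1 < Real.log D := by
  rw [Real.lt_log_iff_exp_lt (by linarith [h.three_le])]
  linarith [h.three_le, Real.exp_one_lt_d9]

lemma two_div_three_le (h : IsExceptionalZero χ β) : 2 / 3 ≤ β := by
  have h1 := h.one_sub_le
  have h2 := h.one_lt_log
  have h3 : (3 * Real.log D)⁻¹ ≤ 3⁻¹ := by
    apply inv_anti₀ (by norm_num)
    linarith
  linarith

lemma lt_one (h : IsExceptionalZero χ β) : β < 1 := by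
  by_contra! hβ
  exact DirichletCharacter.LFunction_ne_zero_of_one_le_re (s := β) _
    (Or.inl (h.isPrimitive.ofReal.ne_one h.one_lt)) (by simpa using hβ) h.apply_eq_zero

lemma abs_smoothedSum_sub_le (h : IsExceptionalZero χ β) {x : ℝ} (hx : 1 ≤ x) :
    |smoothedSum χ β x -
      (realCharLFunction χ 1).re * (x ^ (1 - β) / ((1 - β) * (2 - β)))| ≤
      √D * (1 + Real.log D) * x ^ (-β) * (4 * Real.log x + 24) :=
  _root_.abs_smoothedSum_sub_le h.isPrimitive h.one_lt (abs_charSum_le h.isPrimitive h.one_lt)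
    h.two_div_three_le h.lt_one h.apply_eq_zero hx

/-- `D ^ (1 - β)` is bounded; this is the only use of the closeness of `β` to `1` beyond
`β ≥ 2 / 3`. -/
lemma rpow_one_sub_le (h : IsExceptionalZero χ β) : (D : ℝ) ^ (1 - β) ≤ 3 / 2 := by
  have hD : (0 : ℝ) < D := by linarith [h.three_le]
  have hlog := h.one_lt_log
  have h1 : Real.log D * (1 - β) ≤ 1 / 3 := by
    calc _ ≤ Real.log D * (3 * Real.log D)⁻¹ := by gcongr; exact h.one_sub_le
      _ = _ := by field_simp
  rw [Real.rpow_def_of_pos hD]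
  have h2 := Real.add_one_le_exp (-(1 / 3) : ℝ)
  rw [Real.exp_neg] at h2
  calc _ ≤ Real.exp (1 / 3) := Real.exp_le_exp.mpr h1
    _ = ((Real.exp (1 / 3))⁻¹)⁻¹ := (inv_inv _).symm
    _ ≤ (2 / 3)⁻¹ := inv_anti₀ (by norm_num) (by linarith)
    _ = 3 / 2 := by norm_num

end IsExceptionalZero

lemma tendsto_log_mul_add_div_rpow (a b : ℝ) {r : ℝ} (hr : 0 < r) :
    Tendsto (fun x : ℝ ↦ (a * Real.log x + b) / x ^ r) atTop (𝓝 0) := by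
  have h1 := ((isLittleO_log_rpow_atTop hr).tendsto_div_nhds_zero.const_mul a).add
    ((tendsto_rpow_neg_atTop hr).const_mul b)
  simp only [mul_zero, add_zero] at h1
  refine h1.congr' ?_
  filter_upwards [eventually_gt_atTop 0] with x hx
  rw [Real.rpow_neg hx.le]
  ring

/-- Positivity of `L(1, χ)`: in the asymptotic formula for the smoothed sum the error tends to `0`
as `x → ∞`, while the sum itself stays at least `2 / 3`. -/
lemma IsExceptionalZero.re_realCharLFunction_one_pos {D : ℕ} [NeZero D]
    {χ : DirichletCharacter ℝ D} {β : ℝ} (h : IsExceptionalZero χ β) :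
    0 < (realCharLFunction χ 1).re := by
  have hβ : 0 < β := by linarith [h.two_div_three_le]
  have h1 := (tendsto_log_mul_add_div_rpow 4 24 hβ).const_mul (√D * (1 + Real.log D))
  rw [mul_zero] at h1
  obtain ⟨x, hx, hx3⟩ :=
    ((h1.eventually_lt_const (show (0 : ℝ) < 1 / 2 by norm_num)).and (eventually_ge_atTop 3)).exists
  have h2 := h.abs_smoothedSum_sub_le (x := x) (by linarith)
  have h3 := two_div_three_le_smoothedSum χ β hx3
  have hx0 : 0 < x := by linarith
  have h4 : √D * (1 + Real.log D) * x ^ (-β) * (4 * Real.log x + 24) < 1 / 2 := by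
    rw [Real.rpow_neg hx0.le]
    calc _ = √D * (1 + Real.log D) * ((4 * Real.log x + 24) / x ^ β) := by ring
      _ < _ := hx
  have h5 := (abs_le.mp h2).2
  have h6 : 0 < x ^ (1 - β) / ((1 - β) * (2 - β)) :=
    div_pos (by positivity) (mul_pos (by linarith [h.lt_one]) (by linarith [h.lt_one]))
  by_contra! hneg
  linarith [mul_nonpos_of_nonpos_of_nonneg hneg h6.le]

/-! ### Large conductors and small conductors -/

/-- For large conductors the error term at `x = D` is at most half of the smoothed sum: it is
`O(D ^ (-1 / 2) (log D) ^ 2)`, while the sum is at least `2 / 3`. -/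
lemma exists_forall_large_conductor : ∃ N : ℕ, ∀ (D : ℕ) [NeZero D] (χ : DirichletCharacter ℝ D)
    (β : ℝ), N ≤ D → IsExceptionalZero χ β →
      (realCharLFunction χ 1).re ≤ 3 * ((1 - β) * smoothedSum χ β D) ∧
      (1 - β) * smoothedSum χ β D ≤ 3 * (realCharLFunction χ 1).re := by
  have h1 := ((tendsto_log_mul_add_div_rpow 1 1 (show (0 : ℝ) < 1 / 4 by norm_num)).mul
    (tendsto_log_mul_add_div_rpow 4 24 (show (0 : ℝ) < 1 / 4 by norm_num))).const_mul (3 / 2)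
  rw [mul_zero, mul_zero] at h1
  have h2 := (h1.eventually_le_const (show (0 : ℝ) < 1 / 3 by norm_num))
  obtain ⟨N, hN⟩ := eventually_atTop.mp (tendsto_natCast_atTop_atTop.eventually h2)
  refine ⟨N, fun D _ χ β hD h ↦ ?_⟩
  have hx0 : (0 : ℝ) < D := by linarith [h.three_le]
  have hlog := h.one_lt_log
  have hp : 0 < 1 - β := by linarith [h.lt_one]
  have hβ := h.two_div_three_le
  have hq : 0 < 2 - β := by linarith
  have hL := h.re_realCharLFunction_one_pos
  have hS := two_div_three_le_smoothedSum χ β h.three_le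
  have hDp := h.rpow_one_sub_le
  have hDp1 : 1 ≤ (D : ℝ) ^ (1 - β) := Real.one_le_rpow (by linarith [h.three_le]) hp.le
  have herr : √D * (1 + Real.log D) * (D : ℝ) ^ (-β) * (4 * Real.log D + 24) ≤ 1 / 3 := by
    have hsplit : √D * (D : ℝ) ^ (-β) =
        (D : ℝ) ^ (1 - β) * (((D : ℝ) ^ (1 / 4 : ℝ))⁻¹ * ((D : ℝ) ^ (1 / 4 : ℝ))⁻¹) := by
      rw [Real.sqrt_eq_rpow, ← Real.rpow_neg hx0.le, ← Real.rpow_add hx0, ← Real.rpow_add hx0,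
        ← Real.rpow_add hx0]
      ring_nf
    calc _ = √D * (D : ℝ) ^ (-β) * ((1 + Real.log D) * (4 * Real.log D + 24)) := by ring
      _ = (D : ℝ) ^ (1 - β) * ((1 * Real.log D + 1) / (D : ℝ) ^ (1 / 4 : ℝ) *
          ((4 * Real.log D + 24) / (D : ℝ) ^ (1 / 4 : ℝ))) := by rw [hsplit]; ring
      _ ≤ 3 / 2 * ((1 * Real.log D + 1) / (D : ℝ) ^ (1 / 4 : ℝ) *
          ((4 * Real.log D + 24) / (D : ℝ) ^ (1 / 4 : ℝ))) := by gcongr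
      _ ≤ 1 / 3 := hN D hD
  have hE := abs_le.mp ((h.abs_smoothedSum_sub_le (x := D) (by linarith [h.three_le])).trans herr)
  set L := (realCharLFunction χ 1).re
  set S := smoothedSum χ β D
  have hX : L * ((D : ℝ) ^ (1 - β) / (2 - β)) =
      (1 - β) * (L * ((D : ℝ) ^ (1 - β) / ((1 - β) * (2 - β)))) := by
    field_simp
  have hX1 : 3 / 4 ≤ (D : ℝ) ^ (1 - β) / (2 - β) := by
    rw [le_div_iff₀ hq]; linarith
  have hX2 : (D : ℝ) ^ (1 - β) / (2 - β) ≤ 3 / 2 := by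
    rw [div_le_iff₀ hq]; linarith
  have h3 : (1 - β) * (L * ((D : ℝ) ^ (1 - β) / ((1 - β) * (2 - β)))) ≤ (1 - β) * (3 / 2 * S) :=
    mul_le_mul_of_nonneg_left (by linarith) hp.le
  have h4 : (1 - β) * (1 / 2 * S) ≤ (1 - β) * (L * ((D : ℝ) ^ (1 - β) / ((1 - β) * (2 - β)))) :=
    mul_le_mul_of_nonneg_left (by linarith) hp.le
  rw [← hX] at h3 h4
  have h5 : L * (3 / 4) ≤ L * ((D : ℝ) ^ (1 - β) / (2 - β)) := by gcongr
  have h6 : L * ((D : ℝ) ^ (1 - β) / (2 - β)) ≤ L * (3 / 2) := by gcongr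
  have h7 : 0 < (1 - β) * S := mul_pos hp (by linarith)
  constructor <;> linarith

/-- For a single character: zeros of the `L`-function stay away from `1`, since it does not vanish
there. -/
lemma exists_forall_zero {D : ℕ} [NeZero D] (χ : DirichletCharacter ℝ D) :
    ∃ C : ℝ, 0 < C ∧ ∀ β : ℝ, IsExceptionalZero χ β →
      (realCharLFunction χ 1).re ≤ C * ((1 - β) * smoothedSum χ β D) ∧
      (1 - β) * smoothedSum χ β D ≤ C * (realCharLFunction χ 1).re := by
  by_cases hex : ∃ β, IsExceptionalZero χ β
  swap
  · exact ⟨1, one_pos, fun β h ↦ absurd ⟨β, h⟩ hex⟩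
  obtain ⟨β₀, h₀⟩ := hex
  have hL := h₀.re_realCharLFunction_one_pos
  have hne := h₀.isPrimitive.ofReal.ne_one h₀.one_lt
  have hcont : Continuous fun β : ℝ ↦ realCharLFunction χ β :=
    (DirichletCharacter.differentiable_LFunction hne).continuous.comp Complex.continuous_ofReal
  have hne1 : realCharLFunction χ ((1 : ℝ) : ℂ) ≠ 0 := by
    rw [Complex.ofReal_one]
    exact DirichletCharacter.LFunction_apply_one_ne_zero hne
  obtain ⟨δ, hδ, hball⟩ := Metric.eventually_nhds_iff.mp
    (hcont.continuousAt.eventually_ne hne1)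
  set L := (realCharLFunction χ 1).re
  set B := ∑ n ∈ Finset.Icc 1 ⌊(D : ℝ)⌋₊, oneConvChar χ n
  have hB : 0 ≤ B := Finset.sum_nonneg fun n _ ↦ oneConvChar_nonneg χ n
  have hC1 : 0 < L / (δ * (2 / 3)) := by positivity
  have hC2 : 0 ≤ B / L := by positivity
  refine ⟨L / (δ * (2 / 3)) + B / L, by positivity, fun β h ↦ ?_⟩
  have hβ := h.two_div_three_le
  have hp : 0 < 1 - β := by linarith [h.lt_one]
  have hS := two_div_three_le_smoothedSum χ β h.three_le
  have hSB : smoothedSum χ β D ≤ B := smoothedSum_le_sum χ (by linarith) (Nat.cast_nonneg D)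
  have hδp : δ ≤ 1 - β := by
    by_contra! hlt
    refine hball (y := β) ?_ h.apply_eq_zero
    rw [Real.dist_eq, abs_sub_comm, abs_of_pos hp]
    exact hlt
  have hS0 : 0 ≤ (1 - β) * smoothedSum χ β D := mul_nonneg hp.le (by linarith)
  constructor
  · calc L = L / (δ * (2 / 3)) * (δ * (2 / 3)) := by field_simp
      _ ≤ L / (δ * (2 / 3)) * ((1 - β) * smoothedSum χ β D) := by gcongr
      _ ≤ _ := by gcongr; linarith
  · calc _ ≤ 1 * B := by gcongr; linarith
      _ = B / L * L := by field_simp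
      _ ≤ _ := by gcongr; linarith

/-- There are only finitely many characters of a given modulus, so the constant in
`exists_forall_zero` may be taken to depend on the modulus only. -/
lemma exists_forall_char (D : ℕ) :
    ∃ C : ℝ, 0 < C ∧ ∀ [NeZero D] (χ : DirichletCharacter ℝ D) (β : ℝ), IsExceptionalZero χ β →
      (realCharLFunction χ 1).re ≤ C * ((1 - β) * smoothedSum χ β D) ∧
      (1 - β) * smoothedSum χ β D ≤ C * (realCharLFunction χ 1).re := by
  rcases eq_or_ne D 0 with rfl | hD
  · exact ⟨1, one_pos, fun {h} ↦ absurd rfl h.out⟩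
  have : NeZero D := ⟨hD⟩
  have : Fintype (DirichletCharacter ℝ D) := Fintype.ofFinite _
  choose C hC0 hC using fun χ : DirichletCharacter ℝ D ↦ exists_forall_zero χ
  refine ⟨∑ χ, C χ, Finset.sum_pos (fun χ _ ↦ hC0 χ) Finset.univ_nonempty, fun χ β h ↦ ?_⟩
  have hle : C χ ≤ ∑ χ, C χ :=
    Finset.single_le_sum (fun χ _ ↦ (hC0 χ).le) (Finset.mem_univ χ)
  have hS : 0 ≤ (1 - β) * smoothedSum χ β D :=
    mul_nonneg (by linarith [h.lt_one]) (by linarith [two_div_three_le_smoothedSum χ β h.three_le])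
  exact ⟨(hC χ β h).1.trans (by gcongr),
    (hC χ β h).2.trans (by gcongr; exact h.re_realCharLFunction_one_pos.le)⟩

/-! ### The two-sided bound -/

theorem mainTheorem2 :
    ∃ c C : ℝ, 0 < c ∧ 0 < C ∧
      ∀ (D : ℕ) [NeZero D] (χ : DirichletCharacter ℝ D) (β : ℝ),
        1 < D → χ.IsPrimitive →
        realCharLFunction χ (β : ℂ) = 0 → 1 - β ≤ (3 * Real.log (D : ℝ))⁻¹ →
          (realCharLFunction χ 1).im = 0 ∧
          c * ((1 - β) * smoothedSum χ β (D : ℝ)) ≤ (realCharLFunction χ 1).re ∧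
          (realCharLFunction χ 1).re ≤ C * ((1 - β) * smoothedSum χ β (D : ℝ)) := by
  obtain ⟨N, hN⟩ := exists_forall_large_conductor
  choose C hC0 hC using exists_forall_char
  set C₁ := 3 + ∑ D ∈ Finset.range N, C D with hC₁
  have hsum : 0 ≤ ∑ D ∈ Finset.range N, C D := Finset.sum_nonneg fun D _ ↦ (hC0 D).le
  have hC₁0 : 0 < C₁ := by positivity
  refine ⟨C₁⁻¹, C₁, by positivity, hC₁0, fun D _ χ β hD hχ hzero hβ ↦ ?_⟩
  have h : IsExceptionalZero χ β := ⟨hD, hχ, hzero, hβ⟩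
  obtain ⟨K, hK, h1, h2⟩ : ∃ K ≤ C₁,
      (realCharLFunction χ 1).re ≤ K * ((1 - β) * smoothedSum χ β D) ∧
      (1 - β) * smoothedSum χ β D ≤ K * (realCharLFunction χ 1).re := by
    rcases le_or_gt N D with hND | hND
    · exact ⟨3, by linarith, hN D χ β hND h⟩
    · refine ⟨C D, ?_, hC D χ β h⟩
      have := Finset.single_le_sum (f := C) (fun D _ ↦ (hC0 D).le) (Finset.mem_range.mpr hND)
      linarith
  have hL := h.re_realCharLFunction_one_pos
  have hS : 0 ≤ (1 - β) * smoothedSum χ β D :=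
    mul_nonneg (by linarith [h.lt_one]) (by linarith [two_div_three_le_smoothedSum χ β h.three_le])
  refine ⟨?_, ?_, h1.trans (by gcongr)⟩
  · rw [realCharLFunction_one_eq_ofReal hχ hD, Complex.ofReal_im]
  · rw [inv_mul_le_iff₀ hC₁0]
    exact h2.trans (by gcongr)
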